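/- Let $\mathbb{D}=\{z\in\mathbb{C}:|z|<1\}$, let $m$ be normalized Lebesgue measure on the unit circle $\mathbb{T}$, and let $H^2$ be the Hardy space, i.e. the Hilbert space of analytic functions $f$ on $\mathbb{D}$ with $$\|f\|_{H^2}^2=\sup_{0<r<1}\int_{\mathbb{T}}|f(r\xi)|^2\,dm(\xi)<\infty .$$ The Cesàro operator on $H^2$ is $$(Cf)(z)=\frac1z\int_0^z\frac{f(\xi)}{1-\xi}\,d\xi,\qquad z\in\mathbb{D}$$ (with the value $f(0)$ at the removable singularity $z=0$). For $\alpha>0$ put $$u_\alpha(z)=\exp\Big(\alpha\,\frac{z+1}{z-1}\Big),\qquad z\in\mathbb{D},$$ and let $(u_\alpha H^2)^\perp=\{f\in H^2:\ f\perp u_\alpha h\ \text{for all } h\in H^2\}$ be the corresponding model space. **Theorem.** For every $\alpha>0$, the model space $(u_\alpha H^2)^\perp$ is a closed invariant subspace of the Cesàro operator: it is a closed linear subspace of $H^2$, and for every $f\in(u_\alpha H^2)^\perp$ the function $Cf$ belongs to $(u_\alpha H^2)^\perp$. -/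

import Mathlib

noncomputable section

namespace Hardy

open Complex Metric Set Filter Topology ComplexConjugate
open scoped InnerProductSpace

/-- The integral mean of `|f|^2` over the circle of radius `r`, with respect to normalized
Lebesgue measure on the unit circle. -/
def circleMean (f : ℂ → ℂ) (r : ℝ) : ℝ :=
  Real.circleAverage (fun z => ‖f z‖ ^ 2) 0 r

/-- The `n`-th Taylor coefficient of `f` at the origin. -/
def taylorCoeff (f : ℂ → ℂ) (n : ℕ) : ℂ := iteratedDeriv n f 0 / (n.factorial : ℂ)

lemma hasSum_taylor {f : ℂ → ℂ} (hf : DifferentiableOn ℂ f (ball 0 1)) {z : ℂ}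
    (hz : z ∈ ball (0 : ℂ) 1) : HasSum (fun n => taylorCoeff f n * z ^ n) (f z) := by
  have h := Complex.hasSum_taylorSeries_on_ball hf hz
  refine h.congr_fun ?_ |> id
  intro n
  simp only [taylorCoeff, sub_zero, smul_eq_mul]
  field_simp

lemma circleMap_mem_unitBall {r : ℝ} (hr : r ∈ Ioo (0 : ℝ) 1) (θ : ℝ) :
    circleMap 0 r θ ∈ ball (0 : ℂ) 1 := by
  simp [circleMap, abs_of_pos hr.1, hr.2]

lemma continuous_comp_circleMap {f : ℂ → ℂ} (hf : DifferentiableOn ℂ f (ball 0 1)) {r : ℝ}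
    (hr : r ∈ Ioo (0 : ℝ) 1) : Continuous fun θ => f (circleMap 0 r θ) :=
  hf.continuousOn.comp_continuous (continuous_circleMap 0 r) (circleMap_mem_unitBall hr)

lemma integral_exp_int (k : ℤ) :
    ∫ θ in (0 : ℝ)..(2 * Real.pi), Complex.exp ((k : ℂ) * I * θ) =
      if k = 0 then ((2 * Real.pi : ℝ) : ℂ) else 0 := by
  split_ifs with hk
  · simp [hk]
  · have hc : (k : ℂ) * I ≠ 0 := by simp [hk]
    rw [integral_exp_mul_complex hc]
    have : (k : ℂ) * I * ((2 * Real.pi : ℝ) : ℂ) = k * (2 * Real.pi * I) := by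
      push_cast; ring
    rw [this, Complex.exp_int_mul_two_pi_mul_I]
    simp

/-- Parseval's identity on the circle of radius `r`. -/
lemma hasSum_circleMean {f : ℂ → ℂ} (hf : DifferentiableOn ℂ f (ball 0 1)) {r : ℝ}
    (hr : r ∈ Ioo (0 : ℝ) 1) :
    HasSum (fun n => ‖taylorCoeff f n‖ ^ 2 * r ^ (2 * n)) (circleMean f r) := by
  set a := taylorCoeff f with ha
  have hsum : Summable fun n => ‖a n * (r : ℂ) ^ n‖ :=
    (hasSum_taylor hf (z := (r : ℂ)) (by simp [abs_of_pos hr.1, hr.2])).summable.norm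
  have hnorm : ∀ (n : ℕ) (θ : ℝ), ‖a n * circleMap 0 r θ ^ n‖ = ‖a n * (r : ℂ) ^ n‖ := by
    intro n θ
    simp [circleMap]
  have hE : ∀ θ : ℝ, HasSum
      (fun p : ℕ × ℕ => conj (a p.1 * circleMap 0 r θ ^ p.1) * (a p.2 * circleMap 0 r θ ^ p.2))
      ((‖f (circleMap 0 r θ)‖ ^ 2 : ℝ) : ℂ) := by
    intro θ
    have h1 := hasSum_taylor hf (circleMap_mem_unitBall hr θ)
    have h2 : HasSum (fun n => conj (a n * circleMap 0 r θ ^ n)) (conj (f (circleMap 0 r θ))) :=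
      (Complex.hasSum_conj').2 (by simpa using h1)
    have hs := summable_mul_of_summable_norm (R := ℂ)
      (f := fun n => conj (a n * circleMap 0 r θ ^ n))
      (g := fun n => a n * circleMap 0 r θ ^ n)
      (by simpa only [RCLike.norm_conj, hnorm] using hsum) (by simpa only [hnorm] using hsum)
    have := h2.mul h1 hs
    rwa [Complex.conj_mul', ← Complex.ofReal_pow] at this
  have hI := intervalIntegral.hasSum_integral_of_dominated_convergence
    (μ := MeasureTheory.volume) (a := 0) (b := 2 * Real.pi)
    (F := fun (p : ℕ × ℕ) (θ : ℝ) =>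
      conj (a p.1 * circleMap 0 r θ ^ p.1) * (a p.2 * circleMap 0 r θ ^ p.2))
    (f := fun θ => ((‖f (circleMap 0 r θ)‖ ^ 2 : ℝ) : ℂ))
    (fun p _ => ‖a p.1 * (r : ℂ) ^ p.1‖ * ‖a p.2 * (r : ℂ) ^ p.2‖)
    (fun p => by
      refine Continuous.aestronglyMeasurable ?_
      have := continuous_circleMap (0 : ℂ) r
      fun_prop)
    (fun p => by
      refine Eventually.of_forall fun θ _ => ?_
      rw [norm_mul, RCLike.norm_conj, hnorm, hnorm])
    (Eventually.of_forall fun θ _ => hsum.mul_of_nonneg hsum (fun _ => norm_nonneg _)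
      (fun _ => norm_nonneg _))
    (by simp)
    (Eventually.of_forall fun θ _ => hE θ)
  have hterm : ∀ p : ℕ × ℕ, (∫ θ in (0 : ℝ)..(2 * Real.pi),
      conj (a p.1 * circleMap 0 r θ ^ p.1) * (a p.2 * circleMap 0 r θ ^ p.2)) =
      if p.1 = p.2 then ((2 * Real.pi * (‖a p.1‖ ^ 2 * r ^ (2 * p.1)) : ℝ) : ℂ) else 0 := by
    rintro ⟨m, n⟩
    have : ∀ θ : ℝ, conj (a m * circleMap 0 r θ ^ m) * (a n * circleMap 0 r θ ^ n) =
        (conj (a m) * a n * r ^ (m + n)) * Complex.exp ((((n : ℤ) - m : ℤ) : ℂ) * I * θ) := by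
      intro θ
      have e1 : (((n : ℤ) - m : ℤ) : ℂ) * I * θ = (m : ℂ) * (-(I * θ)) + n * (θ * I) := by
        push_cast; ring
      rw [e1, Complex.exp_add, Complex.exp_nat_mul, Complex.exp_nat_mul]
      simp only [circleMap, map_mul, map_pow, zero_add, Complex.conj_ofReal,
        ← Complex.exp_conj, Complex.conj_I]
      rw [show (θ : ℂ) * -I = -(I * θ) by ring]
      ring
    simp only [this]
    rw [intervalIntegral.integral_const_mul, integral_exp_int]
    by_cases h : m = n
    · subst h
      simp only [sub_self, if_true, Complex.conj_mul']
      push_cast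
      ring
    · have h' : ¬ ((n : ℤ) - m = 0) := by omega
      simp [h, h']
  simp only [hterm] at hI
  have hD : HasSum (fun n : ℕ => ((2 * Real.pi * (‖a n‖ ^ 2 * r ^ (2 * n)) : ℝ) : ℂ))
      (∫ θ in (0 : ℝ)..(2 * Real.pi), ((‖f (circleMap 0 r θ)‖ ^ 2 : ℝ) : ℂ)) := by
    have hinj : Function.Injective (fun n : ℕ => (n, n)) := fun x y h => (Prod.mk.inj h).1
    refine ((hinj.hasSum_iff (f := fun p : ℕ × ℕ => if p.1 = p.2 then
      ((2 * Real.pi * (‖a p.1‖ ^ 2 * r ^ (2 * p.1)) : ℝ) : ℂ) else 0) ?_).2 hI).congr_fun ?_ |> id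
    · rintro ⟨m, n⟩ hmn
      refine if_neg fun h => hmn ⟨m, ?_⟩
      simp only at h
      rw [h]
    · intro n
      simp
  rw [intervalIntegral.integral_ofReal, Complex.hasSum_ofReal] at hD
  have := hD.mul_left (2 * Real.pi)⁻¹
  have hpi : (2 * Real.pi) ≠ 0 := by positivity
  simp only [← mul_assoc, inv_mul_cancel₀ hpi, one_mul] at this
  simpa only [circleMean, Real.circleAverage, smul_eq_mul, mul_assoc] using this

lemma sum_sq_le_of_circleMean_le {f : ℂ → ℂ} (hf : DifferentiableOn ℂ f (ball 0 1)) {M : ℝ}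
    (hM : ∀ r ∈ Ioo (0 : ℝ) 1, circleMean f r ≤ M) (s : Finset ℕ) :
    ∑ n ∈ s, ‖taylorCoeff f n‖ ^ 2 ≤ M := by
  have hlim : Tendsto (fun r : ℝ => ∑ n ∈ s, ‖taylorCoeff f n‖ ^ 2 * r ^ (2 * n)) (𝓝[<] 1)
      (𝓝 (∑ n ∈ s, ‖taylorCoeff f n‖ ^ 2)) := by
    have hc : Continuous (fun r : ℝ => ∑ n ∈ s, ‖taylorCoeff f n‖ ^ 2 * r ^ (2 * n)) := by
      fun_prop
    have := (hc.tendsto 1).mono_left (nhdsWithin_le_nhds (s := Iio 1))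
    simpa using this
  refine le_of_tendsto hlim ?_
  filter_upwards [Ioo_mem_nhdsLT (zero_lt_one' ℝ)] with r hr
  have h := hasSum_circleMean hf hr
  refine (sum_le_hasSum s (fun n _ => ?_) h).trans (hM r hr)
  have := hr.1
  positivity

/-- The analytic functions on the open unit disk `𝔻` with
`sup_{0 < r < 1} ∫_𝕋 |f(r ξ)|^2 dm(ξ) < ∞`, as a space of functions. A function on `𝔻` is
represented by its extension by zero to `ℂ`. -/
def hardySubmodule : Submodule ℂ (ℂ → ℂ) where
  carrier := {f | DifferentiableOn ℂ f (ball 0 1) ∧ (∀ z ∉ ball (0 : ℂ) 1, f z = 0) ∧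
    BddAbove (circleMean f '' Ioo 0 1)}
  zero_mem' := ⟨differentiableOn_const 0, fun _ _ => rfl, 0, by
    rintro _ ⟨r, -, rfl⟩
    simp [circleMean, Real.circleAverage]⟩
  add_mem' := by
    rintro f g ⟨hf, hf0, A, hA⟩ ⟨hg, hg0, B, hB⟩
    refine ⟨hf.add hg, fun z hz => by simp [hf0 z hz, hg0 z hz], 2 * A + 2 * B, ?_⟩
    rintro _ ⟨r, hr, rfl⟩
    have h1 : circleMean f r ≤ A := hA ⟨r, hr, rfl⟩
    have h2 : circleMean g r ≤ B := hB ⟨r, hr, rfl⟩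
    have cf := continuous_comp_circleMap hf hr
    have cg := continuous_comp_circleMap hg hr
    have key : circleMean (f + g) r ≤ 2 * circleMean f r + 2 * circleMean g r := by
      simp only [circleMean, Real.circleAverage, smul_eq_mul, Pi.add_apply]
      have hp : 0 ≤ (2 * Real.pi)⁻¹ := by positivity
      have : ∫ θ in (0 : ℝ)..(2 * Real.pi), ‖f (circleMap 0 r θ) + g (circleMap 0 r θ)‖ ^ 2 ≤
          ∫ θ in (0 : ℝ)..(2 * Real.pi),
            (2 * ‖f (circleMap 0 r θ)‖ ^ 2 + 2 * ‖g (circleMap 0 r θ)‖ ^ 2) := by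
        refine intervalIntegral.integral_mono_on (by positivity)
          (Continuous.intervalIntegrable ((cf.add cg).norm.pow 2) _ _)
          (Continuous.intervalIntegrable (((cf.norm.pow 2).const_mul 2).add ((cg.norm.pow 2).const_mul 2)) _ _) fun θ _ => ?_
        have h := norm_add_le (f (circleMap 0 r θ)) (g (circleMap 0 r θ))
        have h' := norm_nonneg (f (circleMap 0 r θ) + g (circleMap 0 r θ))
        nlinarith [sq_nonneg (‖f (circleMap 0 r θ)‖ - ‖g (circleMap 0 r θ)‖)]
      have cf2 : Continuous fun θ => 2 * ‖f (circleMap 0 r θ)‖ ^ 2 := (cf.norm.pow 2).const_mul 2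
      have cg2 : Continuous fun θ => 2 * ‖g (circleMap 0 r θ)‖ ^ 2 := (cg.norm.pow 2).const_mul 2
      rw [intervalIntegral.integral_add (cf2.intervalIntegrable _ _) (cg2.intervalIntegrable _ _),
        intervalIntegral.integral_const_mul, intervalIntegral.integral_const_mul] at this
      have := mul_le_mul_of_nonneg_left this hp
      linarith
    linarith
  smul_mem' := by
    rintro c f ⟨hf, hf0, A, hA⟩
    refine ⟨hf.const_smul c, fun z hz => by simp [hf0 z hz], ‖c‖ ^ 2 * A, ?_⟩
    rintro _ ⟨r, hr, rfl⟩
    have h1 : circleMean f r ≤ A := hA ⟨r, hr, rfl⟩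
    have : circleMean (c • f) r = ‖c‖ ^ 2 * circleMean f r := by
      simp only [circleMean, Real.circleAverage, smul_eq_mul, Pi.smul_apply, norm_mul, mul_pow]
      rw [intervalIntegral.integral_const_mul]
      ring
    rw [this]
    exact mul_le_mul_of_nonneg_left h1 (by positivity)

/-- The Hardy space `H²` of the unit disk. -/
def H2 : Type := hardySubmodule

instance : AddCommGroup H2 := inferInstanceAs (AddCommGroup hardySubmodule)

instance : Module ℂ H2 := inferInstanceAs (Module ℂ hardySubmodule)

instance : CoeFun H2 (fun _ => ℂ → ℂ) := ⟨fun f => f.1⟩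

namespace H2

lemma differentiableOn (f : H2) : DifferentiableOn ℂ f (ball 0 1) := f.2.1

lemma contDiffAt_zero (f : H2) (n : ℕ) : ContDiffAt ℂ n f 0 :=
  (f.differentiableOn.analyticAt (ball_mem_nhds 0 one_pos)).contDiffAt

lemma summable_coeff (f : H2) : Summable fun n => ‖taylorCoeff f n‖ ^ 2 := by
  obtain ⟨M, hM⟩ := f.2.2.2
  exact summable_of_sum_le (fun n => by positivity)
    (sum_sq_le_of_circleMean_le f.differentiableOn fun r hr => hM ⟨r, hr, rfl⟩)

/-- The Taylor coefficients of `f ∈ H²` at the origin, as an element of `ℓ²`. -/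
def coeffs : H2 →ₗ[ℂ] lp (fun _ : ℕ => ℂ) 2 where
  toFun f := ⟨taylorCoeff f, memℓp_gen (by simpa using f.summable_coeff)⟩
  map_add' f g := by
    ext n
    change taylorCoeff (fun z => f z + g z) n = taylorCoeff f n + taylorCoeff g n
    simp only [taylorCoeff]
    rw [iteratedDeriv_fun_add (f.contDiffAt_zero n) (g.contDiffAt_zero n), add_div]
  map_smul' c f := by
    ext n
    change taylorCoeff (fun z => c * f z) n = c * taylorCoeff f n
    simp only [taylorCoeff]
    rw [iteratedDeriv_const_mul_field, mul_div_assoc]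

lemma coeffs_injective : Function.Injective coeffs := by
  intro f g h
  refine Subtype.ext (funext fun z => ?_)
  by_cases hz : z ∈ ball (0 : ℂ) 1
  · have h' : taylorCoeff f = taylorCoeff g := congrArg Subtype.val h
    have h1 := hasSum_taylor f.differentiableOn hz
    have h2 := hasSum_taylor g.differentiableOn hz
    rw [h'] at h1
    exact h1.unique h2
  · exact (f.2.2.1 z hz).trans (g.2.2.1 z hz).symm

/-- The inner product `⟪f, g⟫ = ∑ conj (a_n) b_n` of `H²` (conjugate-linear in the first variable,
the convention of Mathlib), where `a_n`, `b_n` are the Taylor coefficients of `f`, `g`. -/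
@[reducible] def innerCore : InnerProductSpace.Core ℂ H2 where
  inner f g := ⟪coeffs f, coeffs g⟫_ℂ
  conj_inner_symm f g := inner_conj_symm _ _
  re_inner_nonneg f := inner_self_nonneg
  add_left f g h := by simp only [map_add, inner_add_left]
  smul_left f g c := by simp only [map_smul, inner_smul_left]
  definite f h := coeffs_injective (by rw [map_zero]; exact inner_self_eq_zero.1 h)

instance : NormedAddCommGroup H2 := innerCore.toNormedAddCommGroup

instance : InnerProductSpace ℂ H2 := InnerProductSpace.ofCore innerCore.toCore

lemma inner_eq_tsum (f g : H2) :
    ⟪f, g⟫_ℂ = ∑' n, conj (taylorCoeff f n) * taylorCoeff g n := by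
  change ⟪coeffs f, coeffs g⟫_ℂ = _
  rw [lp.inner_eq_tsum]
  refine tsum_congr fun n => ?_
  simp [coeffs, mul_comm]

lemma norm_sq_eq_tsum (f : H2) : ‖f‖ ^ 2 = ∑' n, ‖taylorCoeff f n‖ ^ 2 := by
  rw [← inner_self_eq_norm_sq (𝕜 := ℂ), inner_eq_tsum]
  simp only [Complex.conj_mul', ← Complex.ofReal_pow, ← Complex.ofReal_tsum]
  exact Complex.ofReal_re _

/-- The norm of `H²` is `(sup_{0 < r < 1} ∫_𝕋 |f(r ξ)|^2 dm(ξ))^{1/2}`. -/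
theorem norm_sq_isLUB (f : H2) : IsLUB (circleMean f '' Ioo 0 1) (‖f‖ ^ 2) := by
  rw [norm_sq_eq_tsum]
  constructor
  · rintro _ ⟨r, hr, rfl⟩
    refine hasSum_le (fun n => ?_) (hasSum_circleMean f.differentiableOn hr)
      f.summable_coeff.hasSum
    exact mul_le_of_le_one_right (by positivity) (pow_le_one₀ hr.1.le hr.2.le)
  · intro M hM
    exact f.summable_coeff.tsum_le_of_sum_le
      (sum_sq_le_of_circleMean_le f.differentiableOn fun r hr => hM ⟨r, hr, rfl⟩)

end H2

/-- The subspace `u H² = {u h : h ∈ H²}` of `H²`, for a bounded analytic function `u` on `𝔻`. -/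
def multiples (u : ℂ → ℂ) : Submodule ℂ H2 where
  carrier := {g | ∃ h : H2, ∀ z ∈ ball (0 : ℂ) 1, g z = u z * h z}
  zero_mem' := ⟨0, fun z _ => (mul_zero (u z)).symm⟩
  add_mem' := by
    rintro f g ⟨h, hf⟩ ⟨k, hg⟩
    refine ⟨h + k, fun z hz => ?_⟩
    change f z + g z = u z * (h z + k z)
    rw [hf z hz, hg z hz, mul_add]
  smul_mem' := by
    rintro c f ⟨h, hf⟩
    refine ⟨c • h, fun z hz => ?_⟩
    change c * f z = u z * (c * h z)
    rw [hf z hz, mul_left_comm]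

/-- The model space `(u H²)^⊥`. -/
def modelSpace (u : ℂ → ℂ) : Submodule ℂ H2 := (multiples u)ᗮ

/-- The atomic inner function `u_α(z) = exp (α (z + 1) / (z - 1))`. -/
def atomicInner (α : ℝ) (z : ℂ) : ℂ := Complex.exp (α * ((z + 1) / (z - 1)))

/-- The Cesàro operator `(C f)(z) = (1/z) ∫_0^z f(ξ) / (1 - ξ) dξ`, `z ∈ 𝔻`. The integral is along
the segment `ξ = t z`, `0 ≤ t ≤ 1`, and at the removable singularity `z = 0` the value is the
limit `f 0`. -/
def cesaro (f : ℂ → ℂ) (z : ℂ) : ℂ :=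
  if z = 0 then f 0
  else (1 / z) * ∫ t in (0 : ℝ)..1, f (t * z) / (1 - t * z) * z

end Hardy

end

noncomputable section

namespace Hardy

open Complex Metric Set Filter Topology ComplexConjugate
open scoped InnerProductSpace

/-! ### Power series on the unit disk. -/

section PowerSeries

variable {a : ℕ → ℂ} {f : ℂ → ℂ}

/-! On Taylor coefficients, C replaces a sequence by its running averages (`hasSum_cesaro`), so
Hardy's inequality keeps C f in H². The adjoint should send F to the G with coefficients g_k = ∑_{n
≥ k} F_n / (n + 1), that is g_k - g_{k+1} = F_k / (k + 1). In terms of functions this says ((1 - z)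
G)' = -F, solved by the mean G of F over the segment from z to 1.

The geometric point is that |u_α| decreases along every segment ending at 1. If F = u_α zⁿ, then |F|
≤ |u_α|, so the mean satisfies |G(z)| ≤ |u_α(z)|. As u_α has no zeros, G / u_α is analytic and
bounded, hence G ∈ u_α H² (`exists_mem_multiples_recursion`). For f ⊥ u_α H² this gives ⟨C f, u_α
zⁿ⟩ = ⟨f, G⟩ = 0, and the monomials span a dense subspace of H²
(`mem_modelSpace_of_forall_monomial`).

The adjoint is never built as an operator: `tsum_conj_average_mul` derives the one duality identity
needed from the recursion by summation by parts. -/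

lemma hasFPowerSeriesOnBall_of_hasSum
    (h : ∀ z ∈ ball (0 : ℂ) 1, HasSum (fun n => a n * z ^ n) (f z)) :
    HasFPowerSeriesOnBall f (FormalMultilinearSeries.ofScalars ℂ a) 0 1 where
  r_le := by
    refine ENNReal.le_of_forall_nnreal_lt fun r hr => ?_
    have hr1 : (r : ℝ) < 1 := by exact_mod_cast hr
    refine FormalMultilinearSeries.le_radius_of_summable_norm _ ?_
    have := (h (r : ℝ) (by simpa using hr1)).summable.norm
    simpa [FormalMultilinearSeries.ofScalars_norm] using this
  r_pos := one_pos
  hasSum := by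
    intro y hy
    have hy' : y ∈ ball (0 : ℂ) 1 := by
      rw [← Metric.eball_ofReal]
      simpa using hy
    simpa [FormalMultilinearSeries.ofScalars_apply_eq, mul_comm] using h y hy'

lemma differentiableOn_of_hasSum
    (h : ∀ z ∈ ball (0 : ℂ) 1, HasSum (fun n => a n * z ^ n) (f z)) :
    DifferentiableOn ℂ f (ball 0 1) := by
  have := (hasFPowerSeriesOnBall_of_hasSum h).differentiableOn
  rw [← ENNReal.ofReal_one, Metric.eball_ofReal] at this
  exact this

lemma taylorCoeff_eq_of_hasSum
    (h : ∀ z ∈ ball (0 : ℂ) 1, HasSum (fun n => a n * z ^ n) (f z)) : taylorCoeff f = a := by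
  funext n
  have := (hasFPowerSeriesOnBall_of_hasSum h).factorial_smul 1 n
  simp only [FormalMultilinearSeries.ofScalars_apply_eq, one_pow, smul_eq_mul, mul_one,
    ← iteratedDeriv_eq_iteratedFDeriv, nsmul_eq_mul] at this
  rw [taylorCoeff, ← this, mul_div_cancel_left₀]
  exact_mod_cast n.factorial_ne_zero

end PowerSeries

/-- Each term is at most |a_n|² + |z|^{2n}, by the arithmetic-geometric mean inequality. -/
lemma summable_mul_pow_of_summable_sq {a : ℕ → ℂ} (ha : Summable fun n => ‖a n‖ ^ 2) {z : ℂ}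
    (hz : z ∈ ball (0 : ℂ) 1) : Summable fun n => ‖a n * z ^ n‖ := by
  have hz1 : ‖z‖ < 1 := by simpa using hz
  have hg : Summable fun n : ℕ => (‖z‖ ^ 2) ^ n :=
    summable_geometric_of_lt_one (by positivity) (by nlinarith [norm_nonneg z])
  refine Summable.of_nonneg_of_le (fun n => norm_nonneg _) (fun n => ?_) (ha.add hg)
  rw [norm_mul, norm_pow, ← pow_mul, mul_comm 2 n, pow_mul]
  nlinarith [sq_nonneg (‖a n‖ - ‖z‖ ^ n), sq_nonneg (‖a n‖), sq_nonneg (‖z‖ ^ n)]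

/-! ### Elements of H², monomials and multiplication operators. -/

namespace H2

/-- A function analytic and bounded on the disk defines an element of `H²`. -/
def ofBounded (f : ℂ → ℂ) (hf : DifferentiableOn ℂ f (ball 0 1)) (M : ℝ)
    (hM : ∀ z ∈ ball (0 : ℂ) 1, ‖f z‖ ≤ M) : H2 :=
  ⟨(ball (0 : ℂ) 1).indicator f, hf.congr fun _ hz => indicator_of_mem hz f,
    fun _ hz => indicator_of_notMem hz f, M ^ 2, by
    rintro _ ⟨r, hr, rfl⟩
    have hi : DifferentiableOn ℂ ((ball (0 : ℂ) 1).indicator f) (ball 0 1) :=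
      hf.congr fun _ hz => indicator_of_mem hz f
    refine Real.circleAverage_mono_on_of_le_circle ?_ ?_
    · exact ((continuous_comp_circleMap hi hr).norm.pow 2).intervalIntegrable _ _
    · intro z hz
      have hz' : z ∈ ball (0 : ℂ) 1 := by
        have h1 : ‖z‖ = |r| := by simpa using hz
        rw [abs_of_pos hr.1] at h1
        simpa [h1] using hr.2
      rw [indicator_of_mem hz']
      exact pow_le_pow_left₀ (norm_nonneg _) (hM z hz') 2⟩

lemma ofBounded_apply {f : ℂ → ℂ} {hf : DifferentiableOn ℂ f (ball 0 1)} {M : ℝ}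
    {hM : ∀ z ∈ ball (0 : ℂ) 1, ‖f z‖ ≤ M} {z : ℂ} (hz : z ∈ ball (0 : ℂ) 1) :
    ofBounded f hf M hM z = f z :=
  indicator_of_mem hz f

/-- A square summable sequence is the sequence of Taylor coefficients of an element of `H²`. -/
lemma exists_hasSum_of_summable_sq {a : ℕ → ℂ} (ha : Summable fun n => ‖a n‖ ^ 2) :
    ∃ f : H2, taylorCoeff f = a ∧ ∀ z ∈ ball (0 : ℂ) 1, HasSum (fun n => a n * z ^ n) (f z) := by
  set F : ℂ → ℂ := (ball (0 : ℂ) 1).indicator fun z => ∑' n, a n * z ^ n with hF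
  have hs : ∀ z ∈ ball (0 : ℂ) 1, HasSum (fun n => a n * z ^ n) (F z) := by
    intro z hz
    rw [hF, indicator_of_mem hz]
    exact (summable_mul_pow_of_summable_sq ha hz).of_norm.hasSum
  have hd := differentiableOn_of_hasSum hs
  refine ⟨⟨F, hd, fun z hz => indicator_of_notMem hz _, ∑' n, ‖a n‖ ^ 2, ?_⟩,
    taylorCoeff_eq_of_hasSum hs, hs⟩
  rintro _ ⟨r, hr, rfl⟩
  refine hasSum_le (fun n => ?_) (hasSum_circleMean hd hr) ha.hasSum
  rw [taylorCoeff_eq_of_hasSum hs]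
  exact mul_le_of_le_one_right (by positivity) (pow_le_one₀ hr.1.le hr.2.le)

/-- Makes `coeffs` an isometric embedding, so that convergence in H² can be tested in ℓ². -/
lemma norm_coeffs (f : H2) : ‖coeffs f‖ = ‖f‖ := by
  rw [← sq_eq_sq₀ (norm_nonneg _) (norm_nonneg _), ← inner_self_eq_norm_sq (𝕜 := ℂ),
    ← inner_self_eq_norm_sq (𝕜 := ℂ)]
  rfl

/-- The monomial `z ^ n` as an element of `H²`. -/
def monomial (n : ℕ) : H2 :=
  ofBounded (fun z => z ^ n) (by fun_prop) 1 fun z hz => by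
    rw [norm_pow]
    exact pow_le_one₀ (norm_nonneg _) (mem_ball_zero_iff.1 hz).le

lemma monomial_apply (n : ℕ) {z : ℂ} (hz : z ∈ ball (0 : ℂ) 1) : monomial n z = z ^ n :=
  ofBounded_apply hz

lemma coeffs_monomial (n : ℕ) : coeffs (monomial n) = lp.single 2 n 1 := by
  ext k
  change taylorCoeff (monomial n) k = _
  rw [taylorCoeff_eq_of_hasSum (a := Pi.single n 1)]
  · simp
  · intro z hz
    rw [monomial_apply n hz]
    convert! hasSum_single (f := fun k => (Pi.single n 1 : ℕ → ℂ) k * z ^ k) n ?_ using 1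
    · simp
    · intro k hk
      simp [hk]

/-- The Taylor series of `f ∈ H²` converges to `f` in `H²`. -/
lemma hasSum_monomial (f : H2) : HasSum (fun n => taylorCoeff f n • monomial n) f := by
  let e : H2 →ₗᵢ[ℂ] lp (fun _ : ℕ => ℂ) 2 := ⟨coeffs, norm_coeffs⟩
  rw [← e.isometry.isUniformInducing.isInducing.hasSum_iff (g := e) (f := fun n => taylorCoeff f n • monomial n)]
  convert! lp.hasSum_single (p := 2) (by simp) (coeffs f) using 2 with n
  change coeffs _ = _
  rw [map_smul, coeffs_monomial, ← lp.single_smul]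
  congr 1
  change _ * _ = taylorCoeff f n
  simp

/-- Multiplication by an analytic function bounded by `1`, as an operator on `H²`. -/
def mul (u : ℂ → ℂ) (hu : DifferentiableOn ℂ u (ball 0 1))
    (hb : ∀ z ∈ ball (0 : ℂ) 1, ‖u z‖ ≤ 1) : H2 →L[ℂ] H2 :=
  have hle : ∀ (h : H2), ∀ r ∈ Ioo (0 : ℝ) 1,
      circleMean (fun z => u z * h z) r ≤ circleMean h r := by
    intro h r hr
    refine Real.circleAverage_mono ?_ ?_ ?_
    · exact ((continuous_comp_circleMap (hu.mul h.differentiableOn) hr).norm.pow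
        2).intervalIntegrable _ _
    · exact ((continuous_comp_circleMap h.differentiableOn hr).norm.pow 2).intervalIntegrable _ _
    · intro z hz
      have hz' : z ∈ ball (0 : ℂ) 1 := by
        have h1 : ‖z‖ = |r| := by simpa using hz
        rw [abs_of_pos hr.1] at h1
        simpa [h1] using hr.2
      rw [norm_mul]
      exact pow_le_pow_left₀ (by positivity)
        (mul_le_of_le_one_left (norm_nonneg _) (hb z hz')) 2
  LinearMap.mkContinuous
    { toFun h := ⟨fun z => u z * h z, hu.mul h.differentiableOn,
        fun z hz => mul_eq_zero_of_right (u z) (h.2.2.1 z hz), ‖h‖ ^ 2, by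
          rintro _ ⟨r, hr, rfl⟩
          exact (hle h r hr).trans (h.norm_sq_isLUB.1 ⟨r, hr, rfl⟩)⟩
      map_add' g h := Subtype.ext (funext fun z => mul_add (u z) (g z) (h z))
      map_smul' c h := Subtype.ext (funext fun z => mul_left_comm (u z) c (h z)) } 1
    (by
      intro h
      rw [one_mul, ← sq_le_sq₀ (norm_nonneg _) (norm_nonneg _)]
      refine (norm_sq_isLUB _).2 ?_
      rintro _ ⟨r, hr, rfl⟩
      exact (hle h r hr).trans (h.norm_sq_isLUB.1 ⟨r, hr, rfl⟩))

lemma mul_apply {u : ℂ → ℂ} {hu : DifferentiableOn ℂ u (ball 0 1)}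
    {hb : ∀ z ∈ ball (0 : ℂ) 1, ‖u z‖ ≤ 1} (h : H2) (z : ℂ) : mul u hu hb h z = u z * h z :=
  rfl

end H2

/-- To be orthogonal to `u H²` it suffices to be orthogonal to `u zⁿ` for all `n`. -/
lemma mem_modelSpace_of_forall_monomial {u : ℂ → ℂ} (hu : DifferentiableOn ℂ u (ball 0 1))
    (hb : ∀ z ∈ ball (0 : ℂ) 1, ‖u z‖ ≤ 1) {w : H2}
    (hw : ∀ n, ⟪w, H2.mul u hu hb (H2.monomial n)⟫_ℂ = 0) : w ∈ modelSpace u := by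
  refine (Submodule.mem_orthogonal' _ _).2 ?_
  rintro g ⟨h, hg⟩
  have hgh : g = H2.mul u hu hb h := by
    refine Subtype.ext (funext fun z => ?_)
    by_cases hz : z ∈ ball (0 : ℂ) 1
    · exact hg z hz
    · exact (g.2.2.1 z hz).trans ((H2.mul u hu hb h).2.2.1 z hz).symm
  rw [hgh]
  -- The functional h ↦ ⟨w, u h⟩ is continuous, so it may be applied termwise to the Taylor series
  -- of h.
  have hs := ((innerSL ℂ w).comp (H2.mul u hu hb)).hasSum h.hasSum_monomial
  refine hs.unique ?_
  convert! hasSum_zero (α := ℂ) (β := ℕ) using 2 with n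
  rw [map_smul, ContinuousLinearMap.comp_apply, innerSL_apply_apply, hw, smul_zero]

/-! ### Hardy's inequality and duality for averages. -/

section Averages

/-- Hardy's inequality for finite sums, in the sharp form due to Elliott. -/
lemma sum_sq_average_le (a : ℕ → ℝ) (N : ℕ) :
    ∑ n ∈ Finset.range N, (((∑ k ∈ Finset.range (n + 1), a k) / (n + 1)) ^ 2) ≤
      4 * ∑ n ∈ Finset.range N, a n ^ 2 := by
  set S : ℕ → ℝ := fun n => ∑ k ∈ Finset.range n, a k with hS
  -- The term S_N² / N, which is 0 at N = 0, makes the induction close: passing from N to N + 1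
  -- lowers the left side by N times the square of the difference of consecutive averages.
  have h1 : ∀ N : ℕ, ∑ n ∈ Finset.range N, ((S (n + 1) / (n + 1)) ^ 2 -
      2 * (S (n + 1) / (n + 1)) * a n) + S N ^ 2 / N ≤ 0 := by
    intro N
    induction N with
    | zero => simp [hS]
    | succ N ih =>
      rw [Finset.sum_range_succ]
      have ha : a N = S (N + 1) - S N := by simp [hS, Finset.sum_range_succ]
      suffices (S (N + 1) / (N + 1)) ^ 2 - 2 * (S (N + 1) / (N + 1)) * a N +
          S (N + 1) ^ 2 / (N + 1 : ℕ) ≤ S N ^ 2 / N by linarith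
      rw [ha]
      rcases Nat.eq_zero_or_pos N with rfl | hN
      · simp [hS]
        nlinarith
      · have hN' : (0 : ℝ) < N := by exact_mod_cast hN
        have : S N ^ 2 / N - ((S (N + 1) / (N + 1)) ^ 2 -
            2 * (S (N + 1) / (N + 1)) * (S (N + 1) - S N) + S (N + 1) ^ 2 / (N + 1 : ℕ)) =
            N * (S N / N - S (N + 1) / (N + 1)) ^ 2 := by
          push_cast
          field_simp
          ring
        have h2 : 0 ≤ N * (S N / N - S (N + 1) / (N + 1)) ^ 2 := by positivity
        linarith
  have h2 := h1 N
  have h3 : 0 ≤ S N ^ 2 / N := by positivity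
  rw [Finset.mul_sum, ← sub_nonneg, ← Finset.sum_sub_distrib]
  have h4 : 2 * ∑ n ∈ Finset.range N, ((S (n + 1) / (n + 1)) ^ 2 -
      2 * (S (n + 1) / (n + 1)) * a n) ≤ 0 := by linarith
  rw [Finset.mul_sum] at h4
  -- With A the average, 4a² - A² + 2(A² - 2Aa) = (2a - A)².
  have h5 : -∑ n ∈ Finset.range N, 2 * ((S (n + 1) / (n + 1)) ^ 2 -
      2 * (S (n + 1) / (n + 1)) * a n) ≤
      ∑ n ∈ Finset.range N, (4 * a n ^ 2 - (S (n + 1) / (n + 1)) ^ 2) := by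
    rw [← Finset.sum_neg_distrib]
    refine Finset.sum_le_sum fun n _ => ?_
    nlinarith [sq_nonneg (2 * a n - S (n + 1) / (n + 1))]
  linarith

/-- The averages of the first terms of a sequence. -/
def average (a : ℕ → ℂ) (n : ℕ) : ℂ := (∑ k ∈ Finset.range (n + 1), a k) / (n + 1)

/-- **Hardy's inequality**, qualitative form: averages preserve square summability. -/
lemma summable_sq_average {a : ℕ → ℂ} (ha : Summable fun n => ‖a n‖ ^ 2) :
    Summable fun n => ‖average a n‖ ^ 2 := by
  refine summable_of_sum_range_le (c := 4 * ∑' n, ‖a n‖ ^ 2) (fun n => by positivity) fun N => ?_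
  refine le_trans (Finset.sum_le_sum fun n _ => ?_) ((sum_sq_average_le (fun n => ‖a n‖) N).trans
    (mul_le_mul_of_nonneg_left (ha.sum_le_tsum _ fun n _ => by positivity) (by norm_num)))
  refine pow_le_pow_left₀ (norm_nonneg _) ?_ 2
  rw [average, norm_div]
  have : ‖(n + 1 : ℂ)‖ = n + 1 := by exact_mod_cast Complex.norm_natCast (n + 1)
  rw [this]
  gcongr
  exact norm_sum_le _ _

lemma summable_mul_of_summable_sq {a b : ℕ → ℂ} (ha : Summable fun n => ‖a n‖ ^ 2)
    (hb : Summable fun n => ‖b n‖ ^ 2) : Summable fun n => ‖a n * b n‖ := by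
  refine Summable.of_nonneg_of_le (fun n => norm_nonneg _) (fun n => ?_) (ha.add hb)
  rw [norm_mul]
  nlinarith [sq_nonneg (‖a n‖ - ‖b n‖), sq_nonneg (‖a n‖), sq_nonneg (‖b n‖)]

/-- A sequence `b` with `(n + 1) b n` convergent and `b` summable has `(n + 1) b n → 0`. -/
lemma eq_zero_of_tendsto_succ_mul {b : ℕ → ℂ} {L : ℂ} (hb : Summable fun n => ‖b n‖)
    (hL : Tendsto (fun n : ℕ => (n + 1 : ℂ) * b n) atTop (𝓝 L)) : L = 0 := by
  by_contra h
  have hL' := hL.norm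
  have hpos : 0 < ‖L‖ := norm_pos_iff.2 h
  have hev := hL'.eventually (lt_mem_nhds (half_lt_self hpos))
  obtain ⟨N, hN⟩ := eventually_atTop.1 hev
  -- From index N on, |b_n| exceeds (|L| / 2) / (n + 1), so summability of b would pass to the
  -- harmonic series.
  refine Real.not_summable_one_div_natCast ((summable_nat_add_iff (N + 1)).1 ?_)
  refine Summable.of_nonneg_of_le (fun n => by positivity) (fun n => ?_)
    (((summable_nat_add_iff N).2 hb).mul_left (2 / ‖L‖))
  have h1 := hN (n + N) (by omega)
  have h2 : ‖((n + N : ℕ) + 1 : ℂ)‖ = n + N + 1 := by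
    exact_mod_cast Complex.norm_natCast (n + N + 1)
  rw [norm_mul, h2] at h1
  have h3 : (0 : ℝ) < n + N + 1 := by positivity
  push_cast
  rw [← add_assoc, div_mul_eq_mul_div, div_le_div_iff₀ h3 hpos]
  nlinarith

/-- Duality between averages and a summation operator: if `g k - g (k + 1) = F k / (k + 1)` then
`∑ conj (f k) (g k) = ∑ conj (average f k) (F k)`. -/
lemma tsum_conj_average_mul {f g F : ℕ → ℂ} (hf : Summable fun n => ‖f n‖ ^ 2)
    (hg : Summable fun n => ‖g n‖ ^ 2) (hF : Summable fun n => ‖F n‖ ^ 2)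
    (hrec : ∀ k : ℕ, g k - g (k + 1) = F k / (k + 1)) :
    ∑' k, conj (average f k) * F k = ∑' k, conj (f k) * g k := by
  have hc := summable_sq_average hf
  have conj_sq : ∀ {a : ℕ → ℂ}, Summable (fun n => ‖a n‖ ^ 2) →
      Summable (fun n => ‖conj (a n)‖ ^ 2) := by
    intro a ha
    simpa only [RCLike.norm_conj] using ha
  have s1 := (summable_mul_of_summable_sq (conj_sq hc) hF).of_norm.hasSum.tendsto_sum_nat
  have s2 := (summable_mul_of_summable_sq (conj_sq hf) hg).of_norm.hasSum.tendsto_sum_nat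
  -- Summation by parts. Taking one more term in the first sum leaves a single boundary product. It
  -- converges because both sums do, and its limit is 0 because the product of the averages with g
  -- is summable.
  have key : ∀ N : ℕ, ∑ k ∈ Finset.range (N + 1), conj (f k) * g k -
      ∑ k ∈ Finset.range N, conj (average f k) * F k =
      (N + 1 : ℂ) * (conj (average f N) * g N) := by
    have hA : ∀ N : ℕ, (N + 1 : ℂ) * conj (average f N) =
        ∑ k ∈ Finset.range (N + 1), conj (f k) := by
      intro N
      have : (N + 1 : ℂ) ≠ 0 := by exact_mod_cast N.succ_ne_zero
      simp only [average, map_div₀, map_sum, map_add, map_natCast, map_one]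
      field_simp
    intro N
    induction N with
    | zero => simp [average]
    | succ N ih =>
      rw [Finset.sum_range_succ _ (N + 1),
        Finset.sum_range_succ (fun k => conj (average f k) * F k) N]
      have e1 := hA (N + 1)
      rw [Finset.sum_range_succ, ← hA N] at e1
      have hN : (N + 1 : ℂ) ≠ 0 := by exact_mod_cast N.succ_ne_zero
      have e2 : F N = (N + 1) * (g N - g (N + 1)) := by rw [hrec]; field_simp
      rw [e2]
      linear_combination ih - g (N + 1) * e1
  have hlim := ((tendsto_add_atTop_iff_nat 1).2 s2).sub s1
  simp only [key] at hlim
  exact (sub_eq_zero.1 (eq_zero_of_tendsto_succ_mul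
    (summable_mul_of_summable_sq (conj_sq hc) hg) hlim)).symm

end Averages

/-! ### The Cesàro operator on Taylor coefficients. -/

/-- The Taylor coefficients of `C f` are the averages of those of `f`. -/
lemma hasSum_cesaro {f : ℂ → ℂ} (hf : DifferentiableOn ℂ f (ball 0 1)) {z : ℂ}
    (hz : z ∈ ball (0 : ℂ) 1) :
    HasSum (fun n => average (taylorCoeff f) n * z ^ n) (cesaro f z) := by
  set a := taylorCoeff f with ha
  have hz1 : ‖z‖ < 1 := by simpa using hz
  have hball : ∀ t ∈ Icc (0 : ℝ) 1, (t : ℂ) * z ∈ ball (0 : ℂ) 1 := by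
    intro t ht
    simp only [mem_ball_zero_iff, norm_mul, Complex.norm_real, Real.norm_eq_abs, abs_of_nonneg ht.1]
    exact (mul_le_of_le_one_left (norm_nonneg _) ht.2).trans_lt hz1
  -- Cauchy product of the Taylor series of f with the geometric series; its absolute convergence at
  -- z dominates the series on the whole segment from 0 to z.
  have hquot : ∀ w ∈ ball (0 : ℂ) 1,
      (Summable fun n => ‖(∑ k ∈ Finset.range (n + 1), a k) * w ^ n‖) ∧
      HasSum (fun n => (∑ k ∈ Finset.range (n + 1), a k) * w ^ n) (f w / (1 - w)) := by
    intro w hw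
    have hw1 : ‖w‖ < 1 := by simpa using hw
    have h1 := hasSum_taylor hf hw
    have h2 := hasSum_geometric_of_norm_lt_one hw1
    have h2n : Summable fun n : ℕ => ‖w ^ n‖ := summable_norm_geometric_of_norm_lt_one hw1
    have e : ∀ n, ∑ k ∈ Finset.range (n + 1), a k * w ^ k * w ^ (n - k) =
        (∑ k ∈ Finset.range (n + 1), a k) * w ^ n := by
      intro n
      rw [Finset.sum_mul]
      refine Finset.sum_congr rfl fun k hk => ?_
      rw [mul_assoc, ← pow_add, Nat.add_sub_cancel' (Finset.mem_range_succ_iff.1 hk)]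
    have h3 := hasSum_sum_range_mul_of_summable_norm h1.summable.norm h2n
    have h4 := summable_norm_sum_mul_range_of_summable_norm h1.summable.norm h2n
    simp only [← ha, e] at h3 h4
    rw [show (∑' n, a n * w ^ n) = f w from h1.tsum_eq, h2.tsum_eq, ← div_eq_mul_inv] at h3
    exact ⟨h4, h3⟩
  have hI := intervalIntegral.hasSum_integral_of_dominated_convergence
    (μ := MeasureTheory.volume) (a := 0) (b := 1)
    (F := fun (n : ℕ) (t : ℝ) => (∑ k ∈ Finset.range (n + 1), a k) * (t * z) ^ n)
    (f := fun t : ℝ => f (t * z) / (1 - t * z))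
    (fun n _ => ‖(∑ k ∈ Finset.range (n + 1), a k) * z ^ n‖)
    (fun n => (by fun_prop : Continuous _).aestronglyMeasurable)
    (fun n => by
      refine Eventually.of_forall fun t ht => ?_
      rw [uIoc_of_le zero_le_one] at ht
      rw [norm_mul, norm_mul, mul_pow, norm_mul]
      refine mul_le_mul_of_nonneg_left (mul_le_of_le_one_left (norm_nonneg _) ?_) (norm_nonneg _)
      rw [norm_pow, Complex.norm_real, Real.norm_eq_abs, abs_of_pos ht.1]
      exact pow_le_one₀ ht.1.le ht.2)
    (Eventually.of_forall fun t _ => (hquot z hz).1)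
    (by simp)
    (Eventually.of_forall fun t ht => by
      rw [uIoc_of_le zero_le_one] at ht
      exact (hquot _ (hball t ⟨ht.1.le, ht.2⟩)).2)
  have hint : ∀ n : ℕ, ∫ t in (0 : ℝ)..1, (∑ k ∈ Finset.range (n + 1), a k) * (t * z) ^ n =
      average a n * z ^ n := by
    intro n
    have : ∀ t : ℝ, (∑ k ∈ Finset.range (n + 1), a k) * (t * z) ^ n =
        (∑ k ∈ Finset.range (n + 1), a k) * z ^ n * ((t ^ n : ℝ) : ℂ) := by
      intro t
      push_cast
      ring
    simp only [this]
    rw [intervalIntegral.integral_const_mul, intervalIntegral.integral_ofReal, integral_pow]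
    simp only [average]
    push_cast
    simp
    ring
  simp only [hint] at hI
  -- At z = 0 the integral without the factor z already equals f(0), in agreement with the value
  -- prescribed there.
  by_cases h0 : z = 0
  · convert! hI using 1
    simp [cesaro, h0]
  · convert! hI using 1
    rw [cesaro, if_neg h0, intervalIntegral.integral_mul_const]
    field_simp

/-- The Cesàro operator maps `H²` to itself. -/
lemma exists_eq_cesaro (f : H2) : ∃ g : H2, taylorCoeff g = average (taylorCoeff f) ∧
    ∀ z ∈ ball (0 : ℂ) 1, g z = cesaro f z := by
  obtain ⟨g, hg, hs⟩ := H2.exists_hasSum_of_summable_sq (summable_sq_average f.summable_coeff)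
  exact ⟨g, hg, fun z hz => (hs z hz).unique (hasSum_cesaro f.differentiableOn hz)⟩

/-! ### Averaging over segments ending at 1. -/

section Primitive

/-- The point `1 - x (1 - z)` of the segment from `z` to `1` lies in the disk. -/
lemma one_sub_mul_mem_ball {z : ℂ} (hz : z ∈ ball (0 : ℂ) 1) {x : ℝ} (hx : x ∈ Ioc (0 : ℝ) 1) :
    1 - (x : ℂ) * (1 - z) ∈ ball (0 : ℂ) 1 := by
  have hz1 : ‖z‖ < 1 := by simpa using hz
  have h := norm_add_le ((1 - x : ℝ) : ℂ) ((x : ℂ) * z)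
  rw [norm_mul, Complex.norm_real, Complex.norm_real, Real.norm_eq_abs, Real.norm_eq_abs,
    abs_of_nonneg (sub_nonneg.2 hx.2), abs_of_pos hx.1] at h
  have e : 1 - (x : ℂ) * (1 - z) = ((1 - x : ℝ) : ℂ) + x * z := by push_cast; ring
  rw [mem_ball_zero_iff, e]
  nlinarith [hx.1, hx.2]

/-- If `F` is bounded analytic, there is an analytic `G` with `((1 - z) G)' = -F`, namely the
average of `F` over the segment from `z` to `1`. -/
lemma exists_average_to_one {F : ℂ → ℂ} (hF : DifferentiableOn ℂ F (ball 0 1))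
    (hb : ∀ z ∈ ball (0 : ℂ) 1, ‖F z‖ ≤ 1) :
    ∃ G Φ : ℂ → ℂ, DifferentiableOn ℂ G (ball 0 1) ∧
      (∀ z ∈ ball (0 : ℂ) 1, (1 - z) * G z = Φ z ∧ HasDerivAt Φ (-F z) z) ∧
      ∀ z ∈ ball (0 : ℂ) 1, ∀ M : ℝ,
        (∀ x ∈ Ioc (0 : ℝ) 1, ‖F (1 - x * (1 - z))‖ ≤ M) → ‖G z‖ ≤ M := by
  obtain ⟨P, hP⟩ := hF.isExactOn_ball
  -- As F is bounded, its primitive P is Lipschitz and extends continuously to the boundary; `Q 1`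
  -- serves as P(1), and G = (P(1) - P(z)) / (1 - z).
  have hLip : LipschitzOnWith 1 P (ball 0 1) :=
    (convex_ball (0 : ℂ) 1).lipschitzOnWith_of_nnnorm_hasDerivWithin_le
      (fun z hz => (hP z hz).hasDerivWithinAt) fun z hz => by exact_mod_cast hb z hz
  obtain ⟨Q, hQ, hPQ⟩ := hLip.extend_finite_dimension
  have hne : ∀ z ∈ ball (0 : ℂ) 1, 1 - z ≠ 0 := by
    rintro z hz h
    rw [← sub_eq_zero.1 h] at hz
    simp at hz
  refine ⟨fun z => (Q 1 - P z) / (1 - z), fun z => Q 1 - P z, ?_, ?_, ?_⟩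
  · intro z hz
    exact ((((hP z hz).differentiableAt.const_sub (Q 1)).div
      (differentiableAt_id.const_sub 1) (hne z hz))).differentiableWithinAt
  · intro z hz
    exact ⟨mul_div_cancel₀ _ (hne z hz), (hP z hz).const_sub (Q 1)⟩
  · intro z hz M hM
    rw [norm_div, div_le_iff₀ (norm_pos_iff.2 (hne z hz))]
    -- The parameter x = 0 is the boundary point 1, where P need not be differentiable: the mean
    -- value inequality is used on [x, 1], and then x → 0 by continuity of Q.
    have hs : ∀ x ∈ Ioc (0 : ℝ) 1, ‖Q (1 - x * (1 - z)) - P z‖ ≤ M * ‖1 - z‖ := by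
      intro x hx
      have hd : ∀ y ∈ Icc x 1, HasDerivWithinAt (fun y : ℝ => P (1 - (y : ℂ) * (1 - z)))
          (F (1 - y * (1 - z)) * -(1 - z)) (Icc x 1) y := by
        intro y hy
        have hy' : y ∈ Ioc (0 : ℝ) 1 := ⟨hx.1.trans_le hy.1, hy.2⟩
        have h1 : HasDerivAt (fun y : ℝ => 1 - (y : ℂ) * (1 - z)) (-(1 - z)) y := by
          simpa using ((Complex.ofRealCLM.hasDerivAt (x := y)).mul_const (1 - z)).const_sub 1
        exact ((hP _ (one_sub_mul_mem_ball hz hy')).comp y h1).hasDerivWithinAt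
      have hn : ∀ y ∈ Icc x 1, ‖F (1 - (y : ℂ) * (1 - z)) * -(1 - z)‖ ≤ M * ‖1 - z‖ := by
        intro y hy
        rw [norm_mul, norm_neg]
        exact mul_le_mul_of_nonneg_right (hM y ⟨hx.1.trans_le hy.1, hy.2⟩) (norm_nonneg _)
      have h := (convex_Icc x 1).norm_image_sub_le_of_norm_hasDerivWithin_le hd hn
        (right_mem_Icc.2 hx.2) (left_mem_Icc.2 hx.2)
      rw [hPQ (one_sub_mul_mem_ball hz hx)] at h
      have h1 : (1 : ℂ) - ((1 : ℝ) : ℂ) * (1 - z) = z := by push_cast; ring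
      rw [h1] at h
      refine h.trans (mul_le_of_le_one_right ?_ ?_)
      · exact (norm_nonneg _).trans (hn x (left_mem_Icc.2 hx.2))
      · rw [Real.norm_eq_abs, abs_le]
        constructor <;> linarith [hx.1, hx.2]
    have hcont : Continuous fun x : ℝ => ‖Q (1 - x * (1 - z)) - P z‖ := by
      have := hQ.continuous
      fun_prop
    have ht := (hcont.tendsto 0).mono_left (nhdsWithin_le_nhds (s := Ioi 0))
    simp only [ofReal_zero, zero_mul, sub_zero] at ht
    refine le_of_tendsto ht ?_
    filter_upwards [Ioc_mem_nhdsGT (zero_lt_one' ℝ)] with x hx using hs x hx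

/-- The recursion for the Taylor coefficients given by `((1 - z) G)' = -F`. -/
lemma taylorCoeff_sub_succ {F G Φ : ℂ → ℂ} (hG : DifferentiableOn ℂ G (ball 0 1))
    (h : ∀ z ∈ ball (0 : ℂ) 1, (1 - z) * G z = Φ z ∧ HasDerivAt Φ (-F z) z) (k : ℕ) :
    taylorCoeff G k - taylorCoeff G (k + 1) = taylorCoeff F k / (k + 1) := by
  set g := taylorCoeff G with hg
  -- Multiplication by z shifts the coefficients, with 0 entering at index 0.
  have hcoeff : taylorCoeff Φ = fun n => g n - Nat.casesOn n 0 g := by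
    refine taylorCoeff_eq_of_hasSum fun z hz => ?_
    have h1 := hasSum_taylor hG hz
    have h2 : HasSum (fun n => (Nat.casesOn n 0 g : ℂ) * z ^ n) (z * G z) := by
      refine (hasSum_nat_add_iff' 1).1 ?_
      convert! h1.mul_left z using 1
      · funext n
        simp only [← hg]
        ring
      · simp
    have h3 := h1.sub h2
    rw [← (h z hz).1]
    convert! h3 using 1
    · funext n
      simp only [← hg]
      ring
    · ring
  have h1 : taylorCoeff Φ (k + 1) = -taylorCoeff F k / (k + 1) := by
    have hev : deriv Φ =ᶠ[𝓝 0] fun z => -F z := by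
      filter_upwards [ball_mem_nhds (0 : ℂ) one_pos] with z hz using (h z hz).2.deriv
    have hk : (k + 1 : ℂ) ≠ 0 := by exact_mod_cast k.succ_ne_zero
    have hk' : (k.factorial : ℂ) ≠ 0 := by exact_mod_cast k.factorial_ne_zero
    rw [taylorCoeff, taylorCoeff, iteratedDeriv_succ', hev.iteratedDeriv_eq k,
      iteratedDeriv_fun_neg, Nat.factorial_succ]
    push_cast
    field_simp
  rw [hcoeff] at h1
  simp only at h1
  rw [neg_div] at h1
  linear_combination -h1

end Primitive

/-! ### The modulus of u_α. -/

section AtomicInner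

variable {α : ℝ}

lemma differentiableOn_atomicInner (α : ℝ) : DifferentiableOn ℂ (atomicInner α) (ball 0 1) := by
  intro z hz
  have : z - 1 ≠ 0 := by
    intro h
    rw [sub_eq_zero.1 h] at hz
    simp at hz
  unfold atomicInner
  have h : DifferentiableAt ℂ (fun z : ℂ => (z + 1) / (z - 1)) z :=
    (differentiableAt_id.add_const 1).div (differentiableAt_id.sub_const 1) this
  exact (h.const_mul (α : ℂ)).cexp.differentiableWithinAt

/-- After clearing |z - 1|², this is just |z|² < 1: the Möbius map 1 / (z - 1) sends the disk to a
half-plane. -/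
lemma re_inv_sub_one_lt {z : ℂ} (hz : z ∈ ball (0 : ℂ) 1) : ((z - 1)⁻¹).re < -1 / 2 := by
  have h1 : ‖z‖ < 1 := by simpa using hz
  have h2 : Complex.normSq z < 1 := by
    rw [Complex.normSq_eq_norm_sq]
    nlinarith [norm_nonneg z]
  have hne : z - 1 ≠ 0 := by
    intro h
    rw [sub_eq_zero.1 h] at h1
    simp at h1
  have h3 := Complex.normSq_pos.2 hne
  rw [Complex.inv_re, div_lt_iff₀ h3]
  rw [Complex.normSq_apply] at *
  simp only [sub_re, sub_im, one_re, one_im] at *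
  nlinarith

/-- Writing (z + 1) / (z - 1) = 1 + 2 / (z - 1) isolates the part that scales simply along segments
ending at 1. -/
lemma norm_atomicInner {z : ℂ} (hz : z ∈ ball (0 : ℂ) 1) :
    ‖atomicInner α z‖ = Real.exp (α * (1 + 2 * ((z - 1)⁻¹).re)) := by
  have hne : z - 1 ≠ 0 := by
    intro h
    rw [sub_eq_zero.1 h] at hz
    simp at hz
  have e : (z + 1) / (z - 1) = ((1 : ℝ) : ℂ) + ((2 : ℝ) : ℂ) * (z - 1)⁻¹ := by
    push_cast
    field_simp
    ring
  rw [atomicInner, Complex.norm_exp, e, Complex.re_ofReal_mul, Complex.add_re,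
    Complex.re_ofReal_mul, Complex.ofReal_re]

lemma norm_atomicInner_le_one (hα : 0 < α) {z : ℂ} (hz : z ∈ ball (0 : ℂ) 1) :
    ‖atomicInner α z‖ ≤ 1 := by
  rw [norm_atomicInner hz, Real.exp_le_one_iff]
  nlinarith [re_inv_sub_one_lt hz]

/-- The modulus of `u_α` decreases along segments ending at `1`. -/
lemma norm_atomicInner_le_of_segment (hα : 0 < α) {z : ℂ} (hz : z ∈ ball (0 : ℂ) 1) {x : ℝ}
    (hx : x ∈ Ioc (0 : ℝ) 1) :
    ‖atomicInner α (1 - x * (1 - z))‖ ≤ ‖atomicInner α z‖ := by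
  rw [norm_atomicInner hz, norm_atomicInner (one_sub_mul_mem_ball hz hx), Real.exp_le_exp]
  -- Moving towards 1 multiplies 1 / (z - 1) by x⁻¹ ≥ 1, and its real part is negative.
  have e : (1 - (x : ℂ) * (1 - z) - 1)⁻¹ = ((x⁻¹ : ℝ) : ℂ) * (z - 1)⁻¹ := by
    rw [show 1 - (x : ℂ) * (1 - z) - 1 = x * (z - 1) by ring, mul_inv, Complex.ofReal_inv]
  rw [e, Complex.re_ofReal_mul]
  have h1 := re_inv_sub_one_lt hz
  have h2 := (one_le_inv₀ hx.1).2 hx.2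
  refine mul_le_mul_of_nonneg_left ?_ hα.le
  nlinarith

end AtomicInner

/-- The adjoint of the Cesàro operator maps `u_α zⁿ` into `u_α H²`. -/
lemma exists_mem_multiples_recursion {α : ℝ} (hα : 0 < α) (n : ℕ) :
    ∃ G ∈ multiples (atomicInner α), ∀ k : ℕ, taylorCoeff G k - taylorCoeff G (k + 1) =
      taylorCoeff (H2.mul (atomicInner α) (differentiableOn_atomicInner α)
        (fun _ => norm_atomicInner_le_one hα) (H2.monomial n)) k / (k + 1) := by
  set F := H2.mul (atomicInner α) (differentiableOn_atomicInner α)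
    (fun _ => norm_atomicInner_le_one hα) (H2.monomial n) with hF
  have hFu : ∀ z ∈ ball (0 : ℂ) 1, ‖F z‖ ≤ ‖atomicInner α z‖ := by
    intro z hz
    have hz1 : ‖z‖ < 1 := by simpa using hz
    rw [hF, H2.mul_apply, H2.monomial_apply n hz, norm_mul, norm_pow]
    exact mul_le_of_le_one_right (norm_nonneg _) (pow_le_one₀ (norm_nonneg _) hz1.le)
  obtain ⟨G, Φ, hG, hΦ, hM⟩ := exists_average_to_one F.differentiableOn
    fun z hz => (hFu z hz).trans (norm_atomicInner_le_one hα hz)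
  have hGu : ∀ z ∈ ball (0 : ℂ) 1, ‖G z‖ ≤ ‖atomicInner α z‖ := fun z hz =>
    hM z hz _ fun x hx => (hFu _ (one_sub_mul_mem_ball hz hx)).trans
      (norm_atomicInner_le_of_segment hα hz hx)
  have hu0 : ∀ z, atomicInner α z ≠ 0 := fun z => Complex.exp_ne_zero _
  let G' := H2.ofBounded G hG 1 fun z hz => (hGu z hz).trans (norm_atomicInner_le_one hα hz)
  have hG' : ∀ z ∈ ball (0 : ℂ) 1, G' z = G z := fun z hz => H2.ofBounded_apply hz
  -- The cofactor G / u_α is bounded by 1, as |G| ≤ |u_α| on the disk.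
  refine ⟨G', ⟨H2.ofBounded (fun z => G z / atomicInner α z)
    (hG.div (differentiableOn_atomicInner α) fun z _ => hu0 z) 1 fun z hz => ?_, fun z hz => ?_⟩,
    taylorCoeff_sub_succ (Φ := Φ) G'.differentiableOn fun z hz => ?_⟩
  · rw [norm_div]
    exact div_le_one_of_le₀ (hGu z hz) (norm_nonneg _)
  · rw [hG' z hz, H2.ofBounded_apply hz, mul_div_cancel₀ _ (hu0 z)]
  · rw [hG' z hz]
    exact hΦ z hz

end Hardy

end

/-- Invariance is stated through some g agreeing with C f on the disk, since elements of `H2` vanish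
off the disk while the formula for `cesaro` is not truncated there. -/
theorem mainTheorem2 (α : ℝ) (hα : 0 < α) :
    IsClosed (Hardy.modelSpace (Hardy.atomicInner α) : Set Hardy.H2) ∧
      ∀ f ∈ Hardy.modelSpace (Hardy.atomicInner α),
        ∃ g ∈ Hardy.modelSpace (Hardy.atomicInner α),
          ∀ z ∈ Metric.ball (0 : ℂ) 1, g z = Hardy.cesaro f z := by
  refine ⟨Submodule.isClosed_orthogonal _, fun f hf => ?_⟩
  obtain ⟨g, hg, hgC⟩ := Hardy.exists_eq_cesaro f
  refine ⟨g, Hardy.mem_modelSpace_of_forall_monomial (Hardy.differentiableOn_atomicInner α)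
    (fun _ => Hardy.norm_atomicInner_le_one hα) fun n => ?_, hgC⟩
  obtain ⟨G, hG, hrec⟩ := Hardy.exists_mem_multiples_recursion hα n
  rw [Hardy.H2.inner_eq_tsum, hg, Hardy.tsum_conj_average_mul f.summable_coeff G.summable_coeff
    (Hardy.H2.summable_coeff _) hrec, ← Hardy.H2.inner_eq_tsum]
  exact (Submodule.mem_orthogonal' _ _).1 hf G hG
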